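/- Let $s>1$ be an integer and let $G_s = C_{s^2-1}\rtimes_\xi C_2=\langle\sigma\rangle\rtimes_\xi\langle\tau\rangle$ be the semidirect product of cyclic groups of orders $s^2-1$ and $2$, with generators $\sigma$ and $\tau$, in which $\xi(\tau)(\sigma)=\sigma^s$. Then for every field $k$ of characteristic $2$, the group algebra $kG_s$ has a separable deformation. Here a $k((t))$-algebra $A_t$ is called a deformation of a $k$-algebra $A$ if there is a $k[[t]]$-algebra structure on the free $k[[t]]$-module $[A]_t := k[[t]]\otimes_k A$ such that $A_t\cong k((t))\otimes_{k[[t]]}[A]_t$ as $k((t))$-algebras and $A\cong [A]_t/t[A]_t$ as $k$-algebras. The deformation is separable if $A_t$ is a separable $k((t))$-algebra, that is, $A_t$ is finite-dimensional over $k((t))$ and $\overline{k((t))}\otimes_{k((t))}A_t$ is a semisimple ring, where $\overline{k((t))}$ is an algebraic closure of $k((t))$. -/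

import Mathlib

open scoped TensorProduct PowerSeries LaurentSeries

universe u

/-- A finite-dimensional algebra `A` over a field `F` is separable if the scalar extension of `A`
to an algebraic closure of `F` is a semisimple ring. -/
def IsSeparableAlgebra (F : Type*) (A : Type*) [Field F] [Ring A] [Algebra F A] : Prop :=
  Module.Finite F A ∧ IsSemisimpleRing (AlgebraicClosure F ⊗[F] A)

/-- The ideal `tR` of a `k[[t]]`-algebra `R`. It is defined as a left ideal; since the image of `t`
is central, it is two-sided (see the next instance). -/
def uniformizerIdeal (k : Type*) (R : Type*) [Field k] [Ring R] [Algebra k⟦X⟧ R] : Ideal R :=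
  Ideal.span {algebraMap k⟦X⟧ R PowerSeries.X}

instance uniformizerIdeal_isTwoSided (k : Type*) (R : Type*) [Field k] [Ring R]
    [Algebra k⟦X⟧ R] : (uniformizerIdeal k R).IsTwoSided := by
  refine ⟨fun {a} b ha => ?_⟩
  obtain ⟨r, rfl⟩ := Ideal.mem_span_singleton'.1 ha
  refine Ideal.mem_span_singleton'.2 ⟨r * b, ?_⟩
  rw [mul_assoc, mul_assoc, Algebra.commutes]

/-- The `k((t))`-algebra `At` is a deformation of the `k`-algebra `A`: there is a `k[[t]]`-algebra
`R`, whose underlying `k[[t]]`-module is (identified with) the free module `k[[t]] ⊗ A`, such that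
`At ≅ k((t)) ⊗ R` as `k((t))`-algebras and `R / tR ≅ A` as `k`-algebras. Here the `k`-algebra
structure of `R` is the restriction of its `k[[t]]`-algebra structure. -/
def IsDeformation (k A At : Type u) [Field k] [Ring A] [Algebra k A]
    [Ring At] [Algebra k⸨X⸩ At] : Prop :=
  ∃ (R : Type u) (_ : Ring R) (_ : Algebra k⟦X⟧ R) (_ : Algebra k R)
    (_ : IsScalarTower k k⟦X⟧ R),
    Nonempty (R ≃ₗ[k⟦X⟧] k⟦X⟧ ⊗[k] A) ∧
    Nonempty (At ≃ₐ[k⸨X⸩] k⸨X⸩ ⊗[k⟦X⟧] R) ∧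
    Nonempty ((R ⧸ uniformizerIdeal k R) ≃ₐ[k] A)

/-- The `k`-algebra `A` has a separable deformation: a deformation over `k((t))` that is
a separable `k((t))`-algebra. -/
def HasSeparableDeformation (k A : Type u) [Field k] [Ring A] [Algebra k A] : Prop :=
  ∃ (At : Type u) (_ : Ring At) (_ : Algebra k⸨X⸩ At),
    IsDeformation k A At ∧ IsSeparableAlgebra k⸨X⸩ At

/-- The cyclic group of order `n` (for `n ≠ 0`), written multiplicatively. -/
abbrev CyclicGrp (n : ℕ) : Type := Multiplicative (ZMod n)

/-- The generator of the cyclic group of order `n`. -/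
def cyclicGen (n : ℕ) : CyclicGrp n := Multiplicative.ofAdd 1

theorem pow_pow_self (s : ℕ) (hs : 1 < s) (g : CyclicGrp (s ^ 2 - 1)) : (g ^ s) ^ s = g := by
  have h1 : 1 ≤ s ^ 2 := Nat.one_le_pow _ _ (by omega)
  have h : g ^ (s ^ 2 - 1) = 1 := by
    apply Multiplicative.toAdd.injective
    simp only [toAdd_pow, toAdd_one, nsmul_eq_mul, ZMod.natCast_self, zero_mul]
  have h2 : s * s = s ^ 2 - 1 + 1 := by rw [Nat.sub_add_cancel h1, pow_two]
  calc (g ^ s) ^ s = g ^ (s * s) := (pow_mul g s s).symm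
    _ = g ^ (s ^ 2 - 1 + 1) := congrArg (g ^ ·) h2
    _ = g := by rw [pow_succ g (s ^ 2 - 1), h, one_mul]

/-- The automorphism `g ↦ g ^ s` of the cyclic group of order `s ^ 2 - 1`. -/
def powAut (s : ℕ) (hs : 1 < s) : MulAut (CyclicGrp (s ^ 2 - 1)) where
  toFun g := g ^ s
  invFun g := g ^ s
  left_inv := pow_pow_self s hs
  right_inv := pow_pow_self s hs
  map_mul' a b := mul_pow a b s

theorem powAut_mul_self (s : ℕ) (hs : 1 < s) : powAut s hs * powAut s hs = 1 :=
  MulEquiv.ext (pow_pow_self s hs)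

/-- The action of the cyclic group of order 2 on the cyclic group of order `s ^ 2 - 1`, in which
the generator acts by `g ↦ g ^ s`. -/
def powAction (s : ℕ) (hs : 1 < s) : CyclicGrp 2 →* MulAut (CyclicGrp (s ^ 2 - 1)) where
  toFun c := if c = 1 then 1 else powAut s hs
  map_one' := if_pos rfl
  map_mul' := by
    have key : ∀ a b : CyclicGrp 2, (a = 1 ∧ b = 1 ∧ a * b = 1) ∨ (a = 1 ∧ b ≠ 1 ∧ a * b ≠ 1) ∨
        (a ≠ 1 ∧ b = 1 ∧ a * b ≠ 1) ∨ (a ≠ 1 ∧ b ≠ 1 ∧ a * b = 1) := by decide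
    intro a b
    rcases key a b with ⟨h1, h2, h3⟩ | ⟨h1, h2, h3⟩ | ⟨h1, h2, h3⟩ | ⟨h1, h2, h3⟩
    · rw [if_pos h1, if_pos h2, if_pos h3, one_mul]
    · rw [if_pos h1, if_neg h2, if_neg h3, one_mul]
    · rw [if_neg h1, if_pos h2, if_neg h3, mul_one]
    · rw [if_neg h1, if_neg h2, if_pos h3, powAut_mul_self]

theorem powAction_gen (s : ℕ) (hs : 1 < s) :
    powAction s hs (cyclicGen 2) (cyclicGen (s ^ 2 - 1)) = cyclicGen (s ^ 2 - 1) ^ s := by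
  have h : cyclicGen 2 ≠ 1 := by decide
  change (if cyclicGen 2 = 1 then (1 : MulAut (CyclicGrp (s ^ 2 - 1))) else powAut s hs) _ = _
  rw [if_neg h]
  rfl

/-- The group `G_s`, the semidirect product of the cyclic group of order `s ^ 2 - 1` and the cyclic
group of order 2, whose generator acts on the former by `g ↦ g ^ s`. -/
abbrev GroupG (s : ℕ) (hs : 1 < s) : Type :=
  CyclicGrp (s ^ 2 - 1) ⋊[powAction s hs] CyclicGrp 2

/-! Let `g = x h` with `h` over `k[[t]]` monic of degree `s - 1` and congruent to `x^(s-1)` modulo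
`t`. Then `p = (g ∘ g - x) / x` lifts `x^(s²-1) - 1`, and `x ↦ g(x)` is an involution θ of `A =
k[[t]][x]/(p)` lifting `σ ↦ σ^s`. Adjoin `y` with `y a = θ(a) y` and `y² = 1 + c y`, where `c = t
q²` and `p = (h - 1) q`. Since `q` kills every `θ(a) - a`, the product is associative; since `c`
vanishes modulo `t`, the reduction is `kG_s` with `y ↦ τ`.

Generically, `h` is chosen so that `x p = g ∘ g - x` is separable (`separable_of_even`,
`separable_of_odd`). Then `A` becomes reduced, and an element of a nilpotent ideal has coordinates
supported on the fixed points of θ. There `c` is invertible, so in characteristic 2 the relation `y²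
= 1 + c y` is separable and the element vanishes (`eq_bot_of_isNilpotent`). This is applied over the
algebraic closure of `k((t))`. -/

/-- The data needed to form a quadratic extension `A ⊕ A y` of the commutative `S`-algebra `A` in
which `y a = θ(a) y` and `y² = 1 + c y`. -/
structure TwistDatum (S A : Type*) [CommRing S] [CommRing A] [Algebra S A] where
  /-- The twisting automorphism. -/
  θ : A →ₐ[S] A
  /-- The linear coefficient of the quadratic relation. -/
  c : A
  θ_θ : ∀ a, θ (θ a) = a
  θ_c : θ c = c
  c_mul : ∀ a, c * θ a = c * a

/-! ### Twisted quadratic extensions -/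

namespace TwistDatum

section Ring

variable {S A : Type*} [CommRing S] [CommRing A] [Algebra S A] (D : TwistDatum S A)

/-- The twisted quadratic extension `A ⊕ A y`. -/
def Ext (_ : TwistDatum S A) : Type _ := A × A

namespace Ext

instance : AddCommGroup D.Ext := inferInstanceAs (AddCommGroup (A × A))

instance {T : Type*} [Semiring T] [Module T A] : Module T D.Ext :=
  inferInstanceAs (Module T (A × A))

instance {T U : Type*} [Semiring T] [Semiring U] [Module T A] [Module U A] [SMul T U]
    [IsScalarTower T U A] : IsScalarTower T U D.Ext :=
  inferInstanceAs (IsScalarTower T U (A × A))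

instance {T : Type*} [Semiring T] [Module T A] [Module.Free T A] : Module.Free T D.Ext :=
  inferInstanceAs (Module.Free T (A × A))

instance {T : Type*} [Semiring T] [Module T A] [Module.Finite T A] : Module.Finite T D.Ext :=
  inferInstanceAs (Module.Finite T (A × A))

theorem finrank_eq {T : Type*} [Ring T] [StrongRankCondition T] [Module T A] [Module.Free T A]
    [Module.Finite T A] : Module.finrank T D.Ext = 2 * Module.finrank T A := by
  rw [two_mul]
  exact Module.finrank_prod

variable {D} in
@[ext] theorem ext {r s : D.Ext} (h1 : r.1 = s.1) (h2 : r.2 = s.2) : r = s := Prod.ext h1 h2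

instance : Mul D.Ext :=
  ⟨fun r s => (r.1 * s.1 + r.2 * D.θ s.2, r.1 * s.2 + r.2 * D.θ s.1 + r.2 * D.θ s.2 * D.c)⟩

instance : One D.Ext := ⟨((1, 0) : A × A)⟩

/-- The element `a + b y`. -/
def mk (a b : A) : D.Ext := (a, b)

@[simp] theorem fst_mk (a b : A) : (mk D a b).1 = a := rfl
@[simp] theorem snd_mk (a b : A) : (mk D a b).2 = b := rfl

variable (r s : D.Ext)

@[simp] theorem fst_mul : (r * s).1 = r.1 * s.1 + r.2 * D.θ s.2 := rfl
@[simp] theorem snd_mul :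
    (r * s).2 = r.1 * s.2 + r.2 * D.θ s.1 + r.2 * D.θ s.2 * D.c := rfl
@[simp] theorem fst_one : (1 : D.Ext).1 = 1 := rfl
@[simp] theorem snd_one : (1 : D.Ext).2 = 0 := rfl
@[simp] theorem fst_zero : (0 : D.Ext).1 = 0 := rfl
@[simp] theorem snd_zero : (0 : D.Ext).2 = 0 := rfl
@[simp] theorem fst_add : (r + s).1 = r.1 + s.1 := rfl
@[simp] theorem snd_add : (r + s).2 = r.2 + s.2 := rfl
@[simp] theorem fst_sub : (r - s).1 = r.1 - s.1 := rfl
@[simp] theorem snd_sub : (r - s).2 = r.2 - s.2 := rfl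
@[simp] theorem fst_smul {T : Type*} [Semiring T] [Module T A] (t : T) : (t • r).1 = t • r.1 := rfl
@[simp] theorem snd_smul {T : Type*} [Semiring T] [Module T A] (t : T) : (t • r).2 = t • r.2 := rfl

instance : Ring D.Ext :=
  { (inferInstance : AddCommGroup D.Ext), (inferInstance : Mul D.Ext),
    (inferInstance : One D.Ext) with
    left_distrib := fun r s w => by ext <;> simp <;> ring
    right_distrib := fun r s w => by ext <;> simp <;> ring
    zero_mul := fun r => by ext <;> simp
    mul_zero := fun r => by ext <;> simp
    one_mul := fun r => by ext <;> simp
    mul_one := fun r => by ext <;> simp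
    mul_assoc := fun r s w => by
      ext
      · simp only [fst_mul, snd_mul, map_add, map_mul, D.θ_θ, D.θ_c]
        -- Associativity holds because `c` does not distinguish `a` from `θ(a)`.
        linear_combination r.2 * D.θ s.2 * D.c_mul w.2
      · simp only [fst_mul, snd_mul, map_add, map_mul, D.θ_θ, D.θ_c]
        linear_combination r.2 * D.θ s.2 * D.c_mul w.1 + r.2 * D.θ s.2 * D.c * D.c_mul w.2 }

instance {T : Type*} [CommSemiring T] [Algebra T S] [Algebra T A] [IsScalarTower T S A] :
    Algebra T D.Ext :=
  Algebra.ofModule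
    (fun t r s => by
      ext <;> simp [smul_add])
    (fun t r s => by
      have h (a : A) : D.θ (t • a) = t • D.θ a := map_smul (D.θ.restrictScalars T) t a
      ext <;> simp [smul_add, h])

theorem algebraMap_eq {T : Type*} [CommSemiring T] [Algebra T S] [Algebra T A]
    [IsScalarTower T S A] (t : T) : algebraMap T D.Ext t = mk D (algebraMap T A t) 0 := by
  rw [Algebra.algebraMap_eq_smul_one]
  ext
  · simp [Algebra.algebraMap_eq_smul_one]
  · simp

/-- The ring homomorphism out of a twisted quadratic extension given by its values on `A` and
on `y`. -/
def lift {B : Type*} [Ring B] (f : A →+* B) (y : B) (hy : ∀ a, y * f a = f (D.θ a) * y)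
    (hyy : y * y = 1 + f D.c * y) : D.Ext →+* B where
  toFun r := f r.1 + f r.2 * y
  map_one' := by simp
  map_zero' := by simp
  map_add' r s := by
    simp only [fst_add, snd_add, map_add, add_mul]
    abel
  map_mul' r s := by
    have h1 : f r.2 * y * f s.1 = f r.2 * f (D.θ s.1) * y := by rw [mul_assoc, hy, mul_assoc]
    have h2 : f r.2 * y * (f s.2 * y) =
        f r.2 * f (D.θ s.2) + f r.2 * f (D.θ s.2) * f D.c * y := by
      rw [mul_assoc, ← mul_assoc y, hy, mul_assoc (f _) y y, hyy]
      simp only [mul_add, mul_one, mul_assoc]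
    simp only [fst_mul, snd_mul, map_add, map_mul, add_mul, mul_add, h1, h2, mul_assoc]
    abel

@[simp] theorem lift_apply {B : Type*} [Ring B] (f : A →+* B) (y : B)
    (hy : ∀ a, y * f a = f (D.θ a) * y) (hyy : y * y = 1 + f D.c * y) (r : D.Ext) :
    lift D f y hy hyy r = f r.1 + f r.2 * y := rfl

/-- The inclusion of `A` into a twisted quadratic extension. -/
def of : A →+* D.Ext where
  toFun a := mk D a 0
  map_one' := rfl
  map_zero' := rfl
  map_add' a b := by ext <;> simp
  map_mul' a b := by ext <;> simp

/-- The generator `y` of a twisted quadratic extension. -/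
def gen : D.Ext := mk D 0 1

@[simp] theorem fst_of (a : A) : (of D a).1 = a := rfl
@[simp] theorem snd_of (a : A) : (of D a).2 = 0 := rfl
@[simp] theorem fst_gen : (gen D).1 = 0 := rfl
@[simp] theorem snd_gen : (gen D).2 = 1 := rfl

theorem gen_mul_of (a : A) : gen D * of D a = of D (D.θ a) * gen D := by ext <;> simp

theorem gen_mul_gen : gen D * gen D = 1 + of D D.c * gen D := by ext <;> simp

theorem of_add_of_mul_gen : of D r.1 + of D r.2 * gen D = r := by ext <;> simp

end Ext

end Ring

/-! ### Nilpotent ideals and semisimplicity in characteristic 2 -/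

section Semisimple

variable {S A : Type*} [CommRing S] [CommRing A] [Algebra S A] {D : TwistDatum S A}

namespace Ext

variable (D) in
/-- The generator is invertible, with inverse `y - c`. -/
theorem gen_mul_gen_sub : gen D * (gen D - of D D.c) = 1 := by
  rw [mul_sub, gen_mul_gen, gen_mul_of, D.θ_c, add_sub_cancel_right]

/-- In a reduced `A`, both coordinates of an element of a nilpotent two-sided ideal are
supported on the fixed points of `θ`. -/
theorem snd_mul_sub_eq_zero [IsReduced A] {J : Ideal D.Ext} [J.IsTwoSided] (hJ : IsNilpotent J)
    {r : D.Ext} (hr : r ∈ J) (u : A) : r.2 * (D.θ u - u) = 0 := by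
  have hmem : of D (r.2 * (D.θ u - u)) ∈ J := by
    -- The commutator with `u` is `r.2 (θ u - u) y`, and `y` is a unit, so the coefficient lies in
    -- `J` and is nilpotent in the reduced ring `A`.
    have h1 : r * of D u - of D u * r ∈ J :=
      J.sub_mem (J.mul_mem_right _ hr) (J.mul_mem_left _ hr)
    have h2 : r * of D u - of D u * r = of D (r.2 * (D.θ u - u)) * gen D := by
      rw [sub_eq_iff_eq_add]
      ext <;> simp <;> ring
    have h3 := J.mul_mem_right (gen D - of D D.c) h1
    rwa [h2, mul_assoc, gen_mul_gen_sub, mul_one] at h3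
  obtain ⟨n, hn⟩ := hJ
  have h4 : of D (r.2 * (D.θ u - u)) ^ n = 0 := by
    have := Ideal.pow_mem_pow hmem n
    rwa [hn] at this
  rw [← map_pow] at h4
  exact eq_zero_of_pow_eq_zero (congrArg Prod.fst h4)

/-- The second coordinate of `r y` is `r.1 + r.2 c`, and `c` already kills `θ u - u`. -/
theorem fst_mul_sub_eq_zero [IsReduced A] {J : Ideal D.Ext} [J.IsTwoSided] (hJ : IsNilpotent J)
    {r : D.Ext} (hr : r ∈ J) (u : A) : r.1 * (D.θ u - u) = 0 := by
  have h := snd_mul_sub_eq_zero hJ (J.mul_mem_right (gen D) hr) u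
  simp only [snd_mul, snd_gen, fst_gen, map_zero, map_one, mul_one, mul_zero, add_zero,
    add_mul] at h
  have h2 : r.2 * D.c * (D.θ u - u) = 0 := by linear_combination r.2 * D.c_mul u
  rwa [h2, add_zero] at h

/-- In characteristic two, if `A` is reduced and the quadratic relation `y² = 1 + c y` is
separable at the fixed points of `θ`, then nilpotent two-sided ideals are zero. -/
theorem eq_bot_of_isNilpotent [IsReduced A] (h2 : (2 : A) = 0)
    (hc : ∀ a, (∀ u, a * (D.θ u - u) = 0) → a * D.c = 0 → a = 0)
    {J : Ideal D.Ext} [J.IsTwoSided] (hJ : IsNilpotent J) : J = ⊥ := by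
  have key : ∀ r ∈ J, r ^ 2 = 0 → r = 0 := by
    intro r hr hrr
    have ha := fst_mul_sub_eq_zero hJ hr
    have hb := snd_mul_sub_eq_zero hJ hr
    rw [pow_two] at hrr
    have e1 : r.1 * r.1 + r.2 * D.θ r.2 = 0 := congrArg Prod.fst hrr
    have e2 : r.1 * r.2 + r.2 * D.θ r.1 + r.2 * D.θ r.2 * D.c = 0 := congrArg Prod.snd hrr
    -- On the fixed points of θ the second coordinate of `r²` is `2 r.1 r.2 + c r.2²`; the first
    -- term dies in characteristic 2, so `(c r.2)² = 0`.
    have e3 : r.2 * D.c = 0 := by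
      refine pow_eq_zero_iff (two_ne_zero) |>.1 ?_
      linear_combination D.c * e2 - D.c * hb r.1 - D.c ^ 2 * hb r.2 - D.c * r.1 * r.2 * h2
    have e4 : r.2 = 0 := hc _ hb e3
    have e5 : r.1 = 0 := by
      rw [e4, zero_mul, add_zero] at e1
      exact eq_zero_of_pow_eq_zero (n := 2) (by rw [pow_two, e1])
    exact Ext.ext e5 e4
  obtain ⟨n, hn⟩ := hJ
  rw [eq_bot_iff]
  intro r hr
  -- Repeated square roots: `r^(2^m)` lies in `J` and has square zero, hence vanishes.
  have hpow : ∀ m, r ^ 2 ^ m = 0 → r = 0 := by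
    intro m
    induction m with
    | zero => simp
    | succ m ih =>
      intro h
      refine ih (key _ ?_ (by rw [← pow_mul, ← pow_succ, h]))
      obtain ⟨j, hj⟩ : ∃ j, 2 ^ m = j + 1 := ⟨2 ^ m - 1, by have := Nat.two_pow_pos m; omega⟩
      rw [hj, pow_succ]
      exact J.mul_mem_left _ hr
  refine hpow n ?_
  have h1 : r ^ n = 0 := by
    have := Ideal.pow_mem_pow hr n
    rwa [hn] at this
  exact pow_eq_zero_of_le Nat.lt_two_pow_self.le h1

theorem isSemisimpleRing [IsReduced A] [IsArtinianRing D.Ext] (h2 : (2 : A) = 0)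
    (hc : ∀ a, (∀ u, a * (D.θ u - u) = 0) → a * D.c = 0 → a = 0) : IsSemisimpleRing D.Ext :=
  IsArtinianRing.isSemisimpleRing_iff_jacobson.2
    (eq_bot_of_isNilpotent h2 hc IsSemiprimaryRing.isNilpotent)

end Ext

end Semisimple

end TwistDatum

/-! ### The polynomial `p` and its involution -/

open Polynomial in
/-- For `g = X h`, the polynomial `(g ∘ g - X) / X`. -/
noncomputable def iterPoly {S : Type*} [CommRing S] (h : S[X]) : S[X] := h.comp (X * h) * h - 1

namespace iterPoly

open Polynomial

section CommRing

variable {S : Type*} [CommRing S]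

theorem X_mul (h : S[X]) : X * iterPoly h = (X * h).comp (X * h) - X := by
  simp [iterPoly]; ring

theorem map {T : Type*} [CommRing T] (f : S →+* T) (h : S[X]) :
    (iterPoly h).map f = iterPoly (h.map f) := by
  simp [iterPoly, Polynomial.map_comp]

theorem X_pow (s : ℕ) (hs : 1 < s) :
    iterPoly (X ^ (s - 1) : S[X]) = X ^ (s ^ 2 - 1) - 1 := by
  obtain ⟨n, rfl⟩ : ∃ n, s = n + 1 := ⟨s - 1, by omega⟩
  have h : (n + 1) ^ 2 - 1 = n + n * n + n := by
    rw [Nat.sub_eq_iff_eq_add (Nat.one_le_pow _ _ (by omega))]; ring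
  rw [iterPoly, h, Nat.add_sub_cancel, X_pow_comp]
  ring

/-- Positive degree of `h` keeps the constant `-1` away from the leading term. For degree `s - 1`
the result is `s² - 1`. -/
theorem monic_natDegree [Nontrivial S] {h : S[X]} (hm : h.Monic) (hd : h.natDegree ≠ 0) :
    (iterPoly h).Monic ∧ (iterPoly h).natDegree = (h.natDegree + 1) ^ 2 - 1 := by
  have hg : (X * h).Monic := monic_X.mul hm
  have hgd : (X * h).natDegree = h.natDegree + 1 := by
    rw [monic_X.natDegree_mul hm, natDegree_X, add_comm]
  have hcomp : (h.comp (X * h)).Monic := hm.comp hg (by omega)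
  have hcd : (h.comp (X * h)).natDegree = h.natDegree * (h.natDegree + 1) := by
    rw [natDegree_comp_eq_of_mul_ne_zero, hgd]
    simp [hm.leadingCoeff, hg.leadingCoeff]
  have hmd : (h.comp (X * h) * h).natDegree = (h.natDegree + 1) ^ 2 - 1 := by
    rw [hcomp.natDegree_mul hm, hcd, eq_comm,
      Nat.sub_eq_iff_eq_add (Nat.one_le_pow _ _ (by omega))]
    ring
  have hpos : 0 < (h.comp (X * h) * h).natDegree := by
    rw [hcomp.natDegree_mul hm]; omega
  have hlt : (1 : S[X]).degree < (h.comp (X * h) * h).degree := by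
    rw [degree_one]; exact natDegree_pos_iff_degree_pos.1 hpos
  refine ⟨(hcomp.mul hm).sub_of_left hlt, ?_⟩
  rw [iterPoly, natDegree_sub_eq_left_of_natDegree_lt (by simpa using hpos), hmd]

/-- Fixed points of `g` are fixed by `g ∘ g`: `h ∘ g - h` is a multiple of `g - x = x (h - 1)`, so
modulo `h - 1` both factors of `(h ∘ g) h` become 1. -/
theorem sub_one_dvd (h : S[X]) : h - 1 ∣ iterPoly h := by
  have h1 : X * h - X ∣ h.comp (X * h) - h := by
    have := sub_dvd_eval_sub (X * h) X (h.map C)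
    rwa [eval_map, eval_map, ← comp, ← comp, comp_X] at this
  obtain ⟨w, hw⟩ := h1
  refine ⟨X * w * h + h + 1, ?_⟩
  rw [iterPoly]
  linear_combination h * hw

/-- The substitution `x ↦ x h(x)`. -/
noncomputable def twist (h : S[X]) : AdjoinRoot (iterPoly h) →ₐ[S] AdjoinRoot (iterPoly h) :=
  AdjoinRoot.liftAlgHom _ (Algebra.ofId S _)
    (aeval (AdjoinRoot.root (iterPoly h)) (X * h)) (by
      have hp : aeval (AdjoinRoot.root (iterPoly h)) (iterPoly h) = 0 := by
        rw [AdjoinRoot.aeval_eq, AdjoinRoot.mk_self]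
      have hx : aeval (AdjoinRoot.root (iterPoly h)) ((X * h).comp (X * h)) =
          AdjoinRoot.root (iterPoly h) := by
        have := congrArg (aeval (AdjoinRoot.root (iterPoly h))) (X_mul h)
        rw [map_mul, hp, mul_zero, map_sub, aeval_X] at this
        exact (sub_eq_zero.1 this.symm)
      change aeval _ (iterPoly h) = 0
      conv_lhs => arg 2; rw [iterPoly]
      rw [aeval_comp] at hx
      rw [map_sub, map_one, map_mul, aeval_comp, hx]
      conv_lhs at hp => arg 2; rw [iterPoly]
      rw [map_sub, map_one, map_mul, aeval_comp] at hp
      rw [mul_comm]; exact hp)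

@[simp] theorem twist_root (h : S[X]) :
    twist h (AdjoinRoot.root _) = aeval (AdjoinRoot.root (iterPoly h)) (X * h) := by
  simp [twist]

theorem twist_twist (h : S[X]) (a : AdjoinRoot (iterPoly h)) : twist h (twist h a) = a := by
  suffices H : (twist h).comp (twist h) = AlgHom.id S _ from congrArg (fun f => f a) H
  apply AdjoinRoot.algHom_ext
  rw [AlgHom.comp_apply, twist_root, ← aeval_algHom_apply, twist_root, ← aeval_comp, AlgHom.id_apply]
  have := congrArg (aeval (AdjoinRoot.root (iterPoly h))) (X_mul h)
  rw [map_mul, AdjoinRoot.aeval_eq (iterPoly h), AdjoinRoot.mk_self, mul_zero, map_sub,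
    aeval_X] at this
  exact (sub_eq_zero.1 this.symm)

variable {h q : S[X]} (hq : (h - 1) * q = iterPoly h)

-- For `a = f(x)`, the difference `f(g) - f(x)` is a multiple of `g - x = x (h - 1)`, and `q (h - 1)
-- = p` is zero in the quotient.
include hq in
theorem aeval_mul_twist (a : AdjoinRoot (iterPoly h)) :
    aeval (AdjoinRoot.root (iterPoly h)) q * twist h a =
      aeval (AdjoinRoot.root (iterPoly h)) q * a := by
  obtain ⟨f, rfl⟩ := AdjoinRoot.mk_surjective a
  rw [← AdjoinRoot.aeval_eq, ← aeval_algHom_apply, twist_root]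
  obtain ⟨w, hw⟩ := sub_dvd_eval_sub (X * h) X (f.map C)
  rw [eval_map, eval_map, ← comp, ← comp, comp_X] at hw
  have h1 := congrArg (aeval (AdjoinRoot.root (iterPoly h))) hw
  have h2 := congrArg (aeval (AdjoinRoot.root (iterPoly h))) hq
  rw [AdjoinRoot.aeval_eq (iterPoly h), AdjoinRoot.mk_self] at h2
  rw [map_sub, aeval_comp] at h1
  simp only [map_mul, map_sub, aeval_X, map_one] at h1 h2 ⊢
  linear_combination aeval (AdjoinRoot.root (iterPoly h)) q * h1 +
    AdjoinRoot.root (iterPoly h) * aeval (AdjoinRoot.root (iterPoly h)) w * h2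

/-- The twist datum on `S[x]/(p)` with involution `x ↦ x h(x)` and linear coefficient
`r q(x)²`. -/
noncomputable def datum (r : S) : TwistDatum S (AdjoinRoot (iterPoly h)) where
  θ := twist h
  c := algebraMap S _ r * aeval (AdjoinRoot.root (iterPoly h)) q ^ 2
  θ_θ := twist_twist h
  θ_c := by
    -- The square makes invariance formal: `q θ(q) = q²`, and applying θ gives `θ(q) q = θ(q)²`.
    have h1 := aeval_mul_twist hq (aeval (AdjoinRoot.root (iterPoly h)) q)
    have h2 := congrArg (twist h) h1
    rw [map_mul, map_mul, twist_twist] at h2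
    rw [map_mul, AlgHom.commutes, map_pow, pow_two, pow_two, ← h2, ← h1, mul_comm (twist h _)]
  c_mul a := by
    rw [pow_two, mul_assoc, mul_assoc, aeval_mul_twist hq, mul_assoc, mul_assoc]

end CommRing

theorem isReduced {F : Type*} [Field F] {p : F[X]} (hp : p.Separable) :
    IsReduced (AdjoinRoot p) :=
  (Ideal.isRadical_iff_quotient_reduced _).1
    (isRadical_iff_span_singleton.1 hp.squarefree.isRadical)

/-- An `a` supported on the fixed points is killed by `θ(x) - x = x (h - 1)`, and `a c = 0` makes it
killed by `q²`. Separability of `x (h - 1) q` makes these coprime, so `a = 0`. The extra factor `x`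
in the hypothesis is needed here. -/
theorem isSemisimpleRing_datum {F : Type*} [Field F] (h2 : (2 : F) = 0) {h q : F[X]}
    (hm : h.Monic) (hd : h.natDegree ≠ 0)
    (hq : (h - 1) * q = iterPoly h) (hsep : (X * iterPoly h).Separable) {r : F} (hr : r ≠ 0) :
    IsSemisimpleRing (datum hq r).Ext := by
  have := isReduced hsep.of_mul_right
  have : Module.Finite F (AdjoinRoot (iterPoly h)) :=
    (AdjoinRoot.powerBasis' (monic_natDegree hm hd).1).finite
  have : IsArtinianRing (datum hq r).Ext := IsArtinianRing.of_finite F _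
  refine TwistDatum.Ext.isSemisimpleRing ?_ ?_
  · rw [← map_ofNat (algebraMap F _), h2, map_zero]
  · intro a ha hac
    have h1 := ha (AdjoinRoot.root _)
    change a * (twist h _ - _) = 0 at h1
    change a * (algebraMap F _ r * aeval (AdjoinRoot.root (iterPoly h)) q ^ 2) = 0 at hac
    rw [← hq, ← mul_assoc] at hsep
    obtain ⟨v, w, hvw⟩ := hsep.isCoprime.pow_right (n := 2)
    have h3 := congrArg (aeval (AdjoinRoot.root (iterPoly h))) hvw
    have h4 : algebraMap F (AdjoinRoot (iterPoly h)) r⁻¹ * algebraMap F _ r = 1 := by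
      rw [← map_mul, inv_mul_cancel₀ hr, map_one]
    rw [twist_root] at h1
    simp only [map_mul, map_sub, aeval_X, map_one, map_add, map_pow] at h1 h3
    generalize aeval (AdjoinRoot.root (iterPoly h)) w = w' at *
    linear_combination -a * h3 + aeval (AdjoinRoot.root (iterPoly h)) v * h1 +
      w' * algebraMap F (AdjoinRoot (iterPoly h)) r⁻¹ * hac
      - a * w' * aeval (AdjoinRoot.root (iterPoly h)) q ^ 2 * h4

/-! ### Choice of `h` and separability of `g ∘ g - x` -/

section Existence

variable {k : Type*} [Field k]

theorem two_eq_zero (F B : Type*) [Field F] [CharP F 2] [Semiring B] [Algebra F B] :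
    (2 : B) = 0 := by
  rw [← map_ofNat (algebraMap F B), CharTwo.two_eq_zero, map_zero]

/-- The variable is transcendental over `k` in every extension field of `k((t))`. -/
theorem not_isIntegral_X {L : Type*} [Field L] [Algebra k⟦X⟧ L]
    (hL : Function.Injective (algebraMap k⟦X⟧ L)) [Algebra k L] [IsScalarTower k k⟦X⟧ L] :
    ¬ IsIntegral k (algebraMap k⟦X⟧ L PowerSeries.X) := by
  rintro ⟨f, hf, h0⟩
  have h1 : aeval (PowerSeries.X : k⟦X⟧) f = 0 := by
    apply hL
    rw [map_zero, ← aeval_algebraMap_apply]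
    exact h0
  have h2 : aeval (PowerSeries.X : k⟦X⟧) f = (f : k⟦X⟧) := by
    have h3 : aeval (PowerSeries.X : k⟦X⟧) = (coeToPowerSeries.algHom k : k[X] →ₐ[k] k⟦X⟧) := by
      ext1
      simp
    rw [h3, coeToPowerSeries.algHom_apply]
    simp
  rw [h2, Polynomial.coe_eq_zero_iff] at h1
  exact hf.ne_zero h1

/-- For even `s` the derivative of `g = x^s + t x` is the constant `t`, so that of `g ∘ g - x` is
`t² - 1 = (t - 1)²`, a unit. -/
theorem separable_of_even {B : Type*} [Field B] [CharP B 2] {s : ℕ} (hs : Even s) (hs1 : 1 < s)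
    {t : B} (ht : t ≠ 1) :
    (X * iterPoly (X ^ (s - 1) + C t)).Separable := by
  have hg : X * (X ^ (s - 1) + C t) = X ^ s + C t * X := by
    rw [mul_add, ← pow_succ', Nat.sub_add_cancel hs1.le, mul_comm X (C t)]
  have hs0 : (s : B) = 0 := (CharP.cast_eq_zero_iff B 2 s).2 hs.two_dvd
  have hd : derivative (X ^ s + C t * X : B[X]) = C t := by
    simp [derivative_X_pow, hs0]
  rw [X_mul, hg, separable_def]
  suffices H : IsUnit (derivative ((X ^ s + C t * X).comp (X ^ s + C t * X) - X : B[X])) by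
    obtain ⟨v, hv⟩ := H.exists_left_inv
    exact ⟨0, v, by rw [zero_mul, zero_add, hv]⟩
  rw [derivative_sub, derivative_comp, hd, C_comp, derivative_X, ← C_1, ← C_mul, ← C_sub]
  refine (isUnit_C.2 (IsUnit.mk0 _ ?_))
  rw [sub_ne_zero, ← pow_two]
  intro h
  have : (t - 1) ^ 2 = 0 := by
    rw [CharTwo.sub_eq_add, CharTwo.add_sq, h, one_pow, CharTwo.add_self_eq_zero]
  exact ht (sub_eq_zero.1 (pow_eq_zero_iff two_ne_zero |>.1 this))

/-- Here `g = x^s + t x^(s-1)` has derivative `x^(s-1)`. A multiple root `x`, with `y = g(x)`,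
satisfies `g(y) = x` and `(x y)^(s-1) = 1`. These force `t = x + y` with `x` and `y` roots of unity,
so `t` would be integral over `k`. -/
theorem separable_of_odd {F : Type*} [Field F] [CharP F 2] [Algebra k F] {s : ℕ} (hs : Odd s)
    (hs1 : 1 < s) {t : F} (ht : ¬ IsIntegral k t) :
    (X * iterPoly (X ^ (s - 1) + C t * X ^ (s - 2))).Separable := by
  obtain ⟨n, rfl⟩ : ∃ n, s = n + 2 := ⟨s - 2, by omega⟩
  have hg : X * (X ^ (n + 1) + C t * X ^ n) = X ^ (n + 2) + C t * X ^ (n + 1) := by ring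
  have hn : Even (n + 1) := by
    rcases hs with ⟨m, hm⟩; exact ⟨m, by omega⟩
  have h0 : ((n + 1 : ℕ) : F) = 0 := (CharP.cast_eq_zero_iff F 2 _).2 hn.two_dvd
  have h1 : ((n + 2 : ℕ) : F) = 1 := by
    rw [show n + 2 = (n + 1) + 1 from rfl, Nat.cast_succ, h0, zero_add]
  have hd : derivative (X ^ (n + 2) + C t * X ^ (n + 1) : F[X]) = X ^ (n + 1) := by
    rw [derivative_add, derivative_C_mul, derivative_X_pow, derivative_X_pow, h0, h1]
    simp
  rw [show n + 2 - 1 = n + 1 from rfl, Nat.add_sub_cancel, X_mul, hg, separable_def,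
    isCoprime_iff_aeval_ne_zero_of_isAlgClosed F (AlgebraicClosure F)]
  intro x
  rw [derivative_sub, derivative_comp, hd, derivative_X]
  by_contra! H
  obtain ⟨H1, H2⟩ := H
  rw [map_sub, aeval_comp] at H1
  simp only [map_sub, map_mul, map_one, aeval_X, aeval_C, map_add, map_pow,
    pow_comp, X_comp] at H1 H2
  set t' := algebraMap F (AlgebraicClosure F) t with ht'
  set y := x ^ (n + 2) + t' * x ^ (n + 1) with hy
  have hxy : (x * y) ^ (n + 1) = 1 := by rw [mul_pow]; linear_combination H2
  have hx0 : x ≠ 0 := by rintro rfl; simp at hxy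
  have hy0 : y ≠ 0 := by intro h; simp [h] at hxy
  have e1 : y = x ^ (n + 1) * (x + t') := by rw [hy]; ring
  have e2 : x = y ^ (n + 1) * (y + t') := by linear_combination -H1
  have htwo : (2 : AlgebraicClosure F) = 0 := two_eq_zero F _
  -- Multiplying `e1` and `e2` produces the factor `(x y)^(n+1) = 1`. Expanding the result in
  -- characteristic 2 gives `t' (x + y) = t'²`.
  have e3 : x * y = (x + t') * (y + t') := by
    calc x * y = (y ^ (n + 1) * (y + t')) * (x ^ (n + 1) * (x + t')) := by rw [← e1, ← e2]
      _ = (x * y) ^ (n + 1) * ((x + t') * (y + t')) := by rw [mul_pow]; ring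
      _ = _ := by rw [hxy, one_mul]
  have ht0 : t' ≠ 0 := by
    rw [ht', Ne, FaithfulSMul.algebraMap_eq_zero_iff]
    rintro rfl
    exact ht isIntegral_zero
  have e4 : t' = x + y := by
    apply mul_left_cancel₀ ht0
    clear_value y
    linear_combination e3 + t' ^ 2 * htwo
  have e5 : x ^ (n + 1) = 1 := by
    apply mul_right_cancel₀ hy0
    rw [one_mul]
    conv_rhs => rw [e1]
    rw [e4]
    linear_combination -x ^ (n + 1) * x * htwo
  have e6 : y ^ (n + 1) = 1 := by rwa [mul_pow, e5, one_mul] at hxy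
  have hint (z : AlgebraicClosure F) (hz : z ^ (n + 1) = 1) : IsIntegral k z :=
    IsIntegral.of_pow (Nat.succ_pos n) (hz ▸ isIntegral_one)
  have := (hint x e5).add (hint y e6)
  rw [← e4, ht', isIntegral_algebraMap_iff (FaithfulSMul.algebraMap_injective _ _)] at this
  exact ht this

theorem exists_deforming_polynomial [CharP k 2] (L : Type*) [Field L] [Algebra k⟦X⟧ L]
    (hL : Function.Injective (algebraMap k⟦X⟧ L))
    {s : ℕ} (hs : 1 < s) :
    ∃ h : k⟦X⟧[X], h.Monic ∧ h.natDegree = s - 1 ∧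
      h.map (PowerSeries.constantCoeff (R := k)) = X ^ (s - 1) ∧
      (X * iterPoly (h.map (algebraMap k⟦X⟧ L))).Separable := by
  let _ : Algebra k L := ((algebraMap k⟦X⟧ L).comp (algebraMap k k⟦X⟧)).toAlgebra
  have : IsScalarTower k k⟦X⟧ L := IsScalarTower.of_algebraMap_eq' rfl
  have hc : CharP L 2 := charP_of_injective_algebraMap (algebraMap k L).injective 2
  have ht := not_isIntegral_X hL
  have hdeg (j : ℕ) (hj : j < s - 1) :
      (C (PowerSeries.X : k⟦X⟧) * X ^ j).degree < ((s - 1 : ℕ) : WithBot ℕ) :=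
    (degree_C_mul_X_pow_le _ _).trans_lt (by exact_mod_cast hj)
  have hmon (j : ℕ) (hj : j < s - 1) :
      (X ^ (s - 1) + C (PowerSeries.X : k⟦X⟧) * X ^ j).Monic :=
    monic_X_pow_add (hdeg j hj)
  have hnat (j : ℕ) (hj : j < s - 1) :
      (X ^ (s - 1) + C (PowerSeries.X : k⟦X⟧) * X ^ j).natDegree = s - 1 := by
    apply natDegree_eq_of_degree_eq_some
    rw [degree_add_eq_left_of_degree_lt (by rw [degree_X_pow]; exact hdeg j hj), degree_X_pow]
  have hred (j : ℕ) : (X ^ (s - 1) + C (PowerSeries.X : k⟦X⟧) * X ^ j).map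
      (PowerSeries.constantCoeff (R := k)) = X ^ (s - 1) := by
    simp
  rcases s.even_or_odd with he | ho
  · refine ⟨_, hmon 0 (by omega), hnat 0 (by omega), hred 0, ?_⟩
    have h1 : algebraMap k⟦X⟧ L PowerSeries.X ≠ 1 := fun h => ht (h ▸ isIntegral_one)
    simpa using separable_of_even he hs h1
  · have hj : s - 2 < s - 1 := by omega
    refine ⟨_, hmon _ hj, hnat _ hj, hred _, ?_⟩
    simpa using separable_of_odd ho hs ht

end Existence

end iterPoly

/-! ### Base change to an extension field -/

namespace iterPoly

open Polynomial TwistDatum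

section BaseChange

variable {S L : Type*} [CommRing S] [Field L] [Algebra S L] {h q : S[X]}

/-- The extension of scalars of `S[x]/(p)` to `L`. -/
noncomputable def rootMap (h : S[X]) :
    AdjoinRoot (iterPoly h) →+* AdjoinRoot (iterPoly (h.map (algebraMap S L))) :=
  AdjoinRoot.lift ((algebraMap L _).comp (algebraMap S L)) (AdjoinRoot.root _) (by
    rw [← eval₂_map, iterPoly.map, ← aeval_def, AdjoinRoot.aeval_eq,
      AdjoinRoot.mk_self])

theorem rootMap_aeval (f : S[X]) :
    rootMap (L := L) h (aeval (AdjoinRoot.root _) f) =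
      aeval (AdjoinRoot.root _) (f.map (algebraMap S L)) := by
  rw [AdjoinRoot.aeval_eq, rootMap, AdjoinRoot.lift_mk, ← eval₂_map, aeval_def]

theorem rootMap_twist (a : AdjoinRoot (iterPoly h)) :
    rootMap (L := L) h (twist h a) = twist _ (rootMap h a) := by
  obtain ⟨f, rfl⟩ := AdjoinRoot.mk_surjective a
  rw [← AdjoinRoot.aeval_eq, ← aeval_algHom_apply, twist_root, ← aeval_comp, rootMap_aeval,
    rootMap_aeval, ← aeval_algHom_apply, twist_root, ← aeval_comp, Polynomial.map_comp,
    Polynomial.map_mul, map_X]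

theorem map_quotient (hq : (h - 1) * q = iterPoly h) :
    (h.map (algebraMap S L) - 1) * q.map (algebraMap S L) =
      iterPoly (h.map (algebraMap S L)) := by
  rw [← iterPoly.map, ← hq, Polynomial.map_mul, Polynomial.map_sub, Polynomial.map_one]

variable (hq : (h - 1) * q = iterPoly h) (r : S)

variable (L) in
/-- The extension of scalars of the twisted quadratic extension of `S[x]/(p)` to `L`. -/
noncomputable def extMap :
    (datum hq r).Ext →ₐ[S] (datum (map_quotient (L := L) hq) (algebraMap S L r)).Ext :=
  { Ext.lift (datum hq r) ((Ext.of _).comp (rootMap h)) (Ext.gen _)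
      (fun a => by
        rw [RingHom.comp_apply, Ext.gen_mul_of, RingHom.comp_apply]
        change _ = Ext.of _ (rootMap h (twist h a)) * _
        rw [rootMap_twist]
        rfl)
      (by
        have hc : rootMap h (datum hq r).c =
            (datum (map_quotient (L := L) hq) (algebraMap S L r)).c := by
          change rootMap h (algebraMap S _ r * aeval (AdjoinRoot.root (iterPoly h)) q ^ 2) = _
          rw [map_mul, map_pow, rootMap_aeval, AdjoinRoot.algebraMap_eq, rootMap,
            AdjoinRoot.lift_of]
          rfl
        rw [Ext.gen_mul_gen, RingHom.comp_apply, hc]) with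
    commutes' := fun t => by
      change Ext.lift (datum hq r) _ _ _ _ (algebraMap S _ t) = _
      rw [Ext.algebraMap_eq, Ext.lift_apply]
      simp only [Ext.fst_mk, Ext.snd_mk, map_zero, zero_mul, add_zero, RingHom.comp_apply]
      rw [Ext.algebraMap_eq, AdjoinRoot.algebraMap_eq, rootMap, AdjoinRoot.lift_of,
        IsScalarTower.algebraMap_apply S L]
      rfl }

theorem extMap_apply (a : (datum hq r).Ext) :
    extMap L hq r a = Ext.of _ (rootMap h a.1) + Ext.of _ (rootMap h a.2) * Ext.gen _ := rfl

/-- An algebra over the base change of `S` that is generated by the image of the twisted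
quadratic extension is all of it. -/
theorem eq_top_of_extMap_mem
    (B : Subalgebra L (datum (map_quotient (L := L) hq) (algebraMap S L r)).Ext)
    (hB : ∀ a, extMap L hq r a ∈ B) : B = ⊤ := by
  have hgen : Ext.gen (datum (map_quotient (L := L) hq) (algebraMap S L r)) ∈ B := by
    have := hB (Ext.gen (datum hq r))
    rwa [extMap_apply, Ext.fst_gen, Ext.snd_gen, map_zero, map_zero, zero_add, map_one, map_one,
      one_mul] at this
  have hroot : Ext.of (datum (map_quotient (L := L) hq) (algebraMap S L r))
      (AdjoinRoot.root (iterPoly (h.map (algebraMap S L)))) ∈ B := by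
    have := hB (Ext.of (datum hq r) (aeval (AdjoinRoot.root (iterPoly h)) (X : S[X])))
    rw [extMap_apply, Ext.fst_of, Ext.snd_of, rootMap_aeval, map_zero, map_zero, zero_mul,
      add_zero, map_X, aeval_X] at this
    exact this
  have hof (a) : Ext.of (datum (map_quotient (L := L) hq) (algebraMap S L r)) a ∈ B := by
    obtain ⟨f, rfl⟩ := AdjoinRoot.mk_surjective a
    induction f using Polynomial.induction_on' with
    | add f g hf hg => rw [map_add, map_add]; exact B.add_mem hf hg
    | monomial n c =>
      rw [← C_mul_X_pow_eq_monomial, map_mul, map_mul, map_pow, map_pow]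
      refine B.mul_mem ?_ (B.pow_mem hroot n)
      have := B.algebraMap_mem c
      rwa [Ext.algebraMap_eq] at this
  rw [eq_top_iff]
  rintro x -
  rw [← Ext.of_add_of_mul_gen _ x]
  exact B.add_mem (hof _) (B.mul_mem (hof _) hgen)

theorem finrank_ext [Nontrivial S] (hm : h.Monic) (hd : h.natDegree ≠ 0) :
    Module.finrank S (datum hq r).Ext = 2 * ((h.natDegree + 1) ^ 2 - 1) := by
  have pb := AdjoinRoot.powerBasis' (monic_natDegree hm hd).1
  have := pb.finite
  have := Module.Free.of_basis pb.basis
  rw [Ext.finrank_eq, (AdjoinRoot.powerBasis' (monic_natDegree hm hd).1).finrank,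
    AdjoinRoot.powerBasis'_dim, (monic_natDegree hm hd).2]

theorem finite_ext [Nontrivial S] (hm : h.Monic) (hd : h.natDegree ≠ 0) :
    Module.Finite S (datum hq r).Ext := by
  have := (AdjoinRoot.powerBasis' (monic_natDegree hm hd).1).finite
  infer_instance

theorem free_ext [Nontrivial S] (hm : h.Monic) (hd : h.natDegree ≠ 0) :
    Module.Free S (datum hq r).Ext := by
  have := Module.Free.of_basis (AdjoinRoot.powerBasis' (monic_natDegree hm hd).1).basis
  infer_instance

/-- The construction commutes with scalar extension: the comparison map hits the generators `x` and
`y`, and both sides have the same dimension over `L`. -/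
theorem isSemisimpleRing_baseChange (K : Type*) [Field K] [Algebra S K] [Algebra K L]
    [IsScalarTower S K L] (h2 : (2 : L) = 0)
    (hm : h.Monic) (hd : h.natDegree ≠ 0)
    (hsep : (X * iterPoly (h.map (algebraMap S L))).Separable) (hr : algebraMap S L r ≠ 0) :
    IsSemisimpleRing (L ⊗[K] (K ⊗[S] (datum hq r).Ext)) := by
  have : Nontrivial S := (algebraMap S L).domain_nontrivial
  have hm' : (h.map (algebraMap S L)).Monic := hm.map _
  have hd' : (h.map (algebraMap S L)).natDegree = h.natDegree := hm.natDegree_map _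
  have hd0 : (h.map (algebraMap S L)).natDegree ≠ 0 := hd' ▸ hd
  have := isSemisimpleRing_datum h2 hm' hd0 (map_quotient hq) hsep hr
  have := finite_ext hq r hm hd
  have := free_ext hq r hm hd
  have := finite_ext (map_quotient (L := L) hq) (algebraMap S L r) hm' hd0
  have : IsScalarTower S K (datum (map_quotient (L := L) hq) (algebraMap S L r)).Ext :=
    inferInstance
  let Φ : L ⊗[K] (K ⊗[S] (datum hq r).Ext) →ₐ[L]
      (datum (map_quotient (L := L) hq) (algebraMap S L r)).Ext :=
    Algebra.TensorProduct.lift (Algebra.ofId L _)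
      (Algebra.TensorProduct.lift (Algebra.ofId K _) (extMap L hq r)
        fun x y => Algebra.commutes x _) fun x y => Algebra.commutes x _
  have hsurj : Function.Surjective Φ := by
    rw [← AlgHom.range_eq_top]
    apply eq_top_of_extMap_mem
    intro a
    exact ⟨1 ⊗ₜ (1 ⊗ₜ a), by
      change Algebra.ofId L _ 1 * (Algebra.ofId K _ 1 * extMap L hq r a) = _
      rw [map_one, map_one, one_mul, one_mul]⟩
  have hfin : Module.finrank L (L ⊗[K] (K ⊗[S] (datum hq r).Ext)) =
      Module.finrank L (datum (map_quotient (L := L) hq) (algebraMap S L r)).Ext := by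
    rw [Module.finrank_baseChange, Module.finrank_baseChange, finrank_ext hq r hm hd,
      finrank_ext _ _ hm' hd0, hd']
  have hinj : Function.Injective Φ :=
    (LinearMap.injective_iff_surjective_of_finrank_eq_finrank (f := Φ.toLinearMap) hfin).2 hsurj
  exact (AlgEquiv.ofBijective Φ ⟨hinj, hsurj⟩).symm.toRingEquiv.isSemisimpleRing

end BaseChange

end iterPoly

/-! ### Reduction modulo `t` to the group algebra -/

theorem MonoidAlgebra.finrank_eq_card (k G : Type*) [Field k] [Finite G] :
    Module.finrank k (MonoidAlgebra k G) = Nat.card G := by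
  have := Fintype.ofFinite G
  rw [(MonoidAlgebra.coeffLinearEquiv k : MonoidAlgebra k G ≃ₗ[k] G →₀ k).finrank_eq, Module.finrank_finsupp_self,
    Nat.card_eq_fintype_card]

theorem SemiconjBy.mul_aeval {k B : Type*} [CommRing k] [Ring B] [Algebra k B] {a u v : B}
    (h : SemiconjBy a u v) (f : Polynomial k) :
    a * Polynomial.aeval u f = Polynomial.aeval v f * a := by
  induction f using Polynomial.induction_on' with
  | add f g hf hg => rw [map_add, map_add, mul_add, add_mul, hf, hg]
  | monomial n c =>
    rw [Polynomial.aeval_monomial, Polynomial.aeval_monomial, Algebra.left_comm, (h.pow_right n).eq,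
      mul_assoc]

theorem cyclicGen_pow (n i : ℕ) : cyclicGen n ^ i = Multiplicative.ofAdd (i : ZMod n) := by
  apply Multiplicative.toAdd.injective
  simp [cyclicGen]

theorem cyclicGen_pow_inj {n i j : ℕ} (hi : i < n) (hj : j < n) :
    cyclicGen n ^ i = cyclicGen n ^ j ↔ i = j := by
  rw [cyclicGen_pow, cyclicGen_pow, Multiplicative.ofAdd.injective.eq_iff,
    ZMod.natCast_eq_natCast_iff', Nat.mod_eq_of_lt hi, Nat.mod_eq_of_lt hj]

theorem cyclicGen_pow_self (n : ℕ) : cyclicGen n ^ n = 1 := by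
  rw [cyclicGen_pow, ZMod.natCast_self, ofAdd_zero]

theorem exists_pow_cyclicGen (n : ℕ) [NeZero n] (g : CyclicGrp n) : ∃ i, cyclicGen n ^ i = g :=
  ⟨(Multiplicative.toAdd g).val, by rw [cyclicGen_pow, ZMod.natCast_zmod_val, ofAdd_toAdd]⟩

namespace GroupG

open Polynomial

variable {k : Type u} [Field k]

/-- The powers of the generator with exponents below `n` are distinct group elements, hence linearly
independent. -/
theorem eq_zero_of_aeval_cyclicGen {n : ℕ} {f : k[X]} (hf : f.natDegree < n)
    (h : aeval (MonoidAlgebra.of k (CyclicGrp n) (cyclicGen n)) f = 0) : f = 0 := by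
  ext j
  rw [coeff_zero]
  rcases lt_or_ge j n with hj | hj
  · rw [aeval_eq_sum_range' hf] at h
    have h1 := congrArg (fun u => u.coeff (cyclicGen n ^ j)) h
    simp only [← map_pow] at h1
    rw [MonoidAlgebra.coeff_sum, Finsupp.finsetSum_apply, Finset.sum_eq_single j] at h1
    · simpa using h1
    · intro i hi hij
      have : cyclicGen n ^ i ≠ cyclicGen n ^ j :=
        fun e => hij ((cyclicGen_pow_inj (Finset.mem_range.1 hi) hj).1 e)
      simp [MonoidAlgebra.of_apply, this]
    · intro hj'
      exact absurd (Finset.mem_range.2 hj) hj'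
  · exact coeff_eq_zero_of_natDegree_lt (hf.trans_le hj)

variable (s : ℕ) (hs : 1 < s)

variable (k) in
/-- The inclusion of the group algebra of the normal cyclic subgroup. -/
noncomputable def inlAlg :
    MonoidAlgebra k (CyclicGrp (s ^ 2 - 1)) →ₐ[k] MonoidAlgebra k (GroupG s hs) :=
  MonoidAlgebra.mapDomainAlgHom k k SemidirectProduct.inl

variable (k) in
/-- The element `τ` of the group algebra. -/
noncomputable def tau : MonoidAlgebra k (GroupG s hs) :=
  MonoidAlgebra.of k _ (SemidirectProduct.inr (cyclicGen 2))

theorem inlAlg_of (g : CyclicGrp (s ^ 2 - 1)) :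
    inlAlg k s hs (MonoidAlgebra.of k _ g) = MonoidAlgebra.of k _ (SemidirectProduct.inl g) := by
  simp [inlAlg]

theorem tau_mul_tau : tau k s hs * tau k s hs = 1 := by
  rw [tau, ← map_mul, ← map_mul, ← pow_two, cyclicGen_pow_self, map_one, map_one]

theorem tau_semiconj :
    SemiconjBy (tau k s hs) (inlAlg k s hs (MonoidAlgebra.of k _ (cyclicGen _)))
      (inlAlg k s hs (MonoidAlgebra.of k _ (cyclicGen _ ^ s))) := by
  rw [SemiconjBy, inlAlg_of, inlAlg_of, tau, ← map_mul, ← map_mul, ← powAction_gen s hs,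
    SemidirectProduct.inl_aut, mul_assoc, ← map_mul, inv_mul_cancel, map_one, mul_one]

theorem left_eq_zero {u v : MonoidAlgebra k (CyclicGrp (s ^ 2 - 1))}
    (h : inlAlg k s hs u + inlAlg k s hs v * tau k s hs = 0) : u = 0 := by
  ext g
  have h1 := congrArg (fun w => w.coeff (SemidirectProduct.inl g)) h
  have h2 (w : MonoidAlgebra k (CyclicGrp (s ^ 2 - 1))) :
      (inlAlg k s hs w).coeff = Finsupp.mapDomain SemidirectProduct.inl w.coeff := rfl
  -- The point lies in the nontrivial coset of the normal cyclic subgroup, off the support of the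
  -- image of `v`.
  have h3 : (inlAlg k s hs v).coeff
      (SemidirectProduct.inl g * (SemidirectProduct.inr (cyclicGen 2))⁻¹) = 0 := by
    rw [h2]
    apply Finsupp.mapDomain_of_notMem_range
    rintro ⟨g', hg'⟩
    have := congrArg SemidirectProduct.rightHom hg'
    rw [map_mul, map_inv, SemidirectProduct.rightHom_inl, SemidirectProduct.rightHom_inl,
      SemidirectProduct.rightHom_inr, one_mul] at this
    revert this
    decide
  rw [tau, MonoidAlgebra.of_apply, MonoidAlgebra.coeff_add, Finsupp.add_apply,
    MonoidAlgebra.coeff_mul_single_apply, h3, h2,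
    Finsupp.mapDomain_apply SemidirectProduct.inl_injective, zero_mul, add_zero] at h1
  exact h1

theorem right_eq_zero {u v : MonoidAlgebra k (CyclicGrp (s ^ 2 - 1))}
    (h : inlAlg k s hs u + inlAlg k s hs v * tau k s hs = 0) : v = 0 := by
  apply left_eq_zero s hs (v := u)
  rw [← zero_mul (tau k s hs), ← h, add_mul, mul_assoc, tau_mul_tau, mul_one, add_comm]

variable {s} {h q : k⟦X⟧[X]}
  (hh : h.map (PowerSeries.constantCoeff (R := k)) = X ^ (s - 1))

include hs hh in
theorem map_iterPoly :
    (iterPoly h).map (PowerSeries.constantCoeff (R := k)) = X ^ (s ^ 2 - 1) - 1 := by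
  rw [iterPoly.map, hh, iterPoly.X_pow s hs]

/-- The reduction `k[[t]][x]/(p) → k[C]` modulo `t`. -/
noncomputable def reduce :
    AdjoinRoot (iterPoly h) →+* MonoidAlgebra k (CyclicGrp (s ^ 2 - 1)) :=
  AdjoinRoot.lift ((algebraMap k _).comp PowerSeries.constantCoeff)
    (MonoidAlgebra.of k _ (cyclicGen _)) (by
      rw [← eval₂_map, map_iterPoly hs hh, ← aeval_def, map_sub, map_pow, aeval_X, map_one,
        ← map_pow, cyclicGen_pow_self, map_one, sub_self])

theorem reduce_aeval (f : k⟦X⟧[X]) :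
    reduce hs hh (aeval (AdjoinRoot.root _) f) =
      aeval (MonoidAlgebra.of k _ (cyclicGen _)) (f.map PowerSeries.constantCoeff) := by
  rw [AdjoinRoot.aeval_eq, reduce, AdjoinRoot.lift_mk, ← eval₂_map, aeval_def]

/-- Modulo `t` the substitution `x ↦ x h(x)` becomes `σ ↦ σ^s`, which is conjugation by `τ`. -/
theorem reduce_twist (a : AdjoinRoot (iterPoly h)) :
    tau k s hs * inlAlg k s hs (reduce hs hh a) =
      inlAlg k s hs (reduce hs hh (iterPoly.twist h a)) * tau k s hs := by
  obtain ⟨f, rfl⟩ := AdjoinRoot.mk_surjective a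
  have h1 : (X * X ^ (s - 1) : k[X]) = X ^ s := by
    rw [← pow_succ', Nat.sub_add_cancel hs.le]
  rw [← AdjoinRoot.aeval_eq, ← aeval_algHom_apply (iterPoly.twist h), iterPoly.twist_root, ← aeval_comp,
    reduce_aeval, reduce_aeval, Polynomial.map_comp, Polynomial.map_mul, map_X, hh, h1,
    aeval_comp, map_pow, aeval_X, ← map_pow, ← aeval_algHom_apply, ← aeval_algHom_apply,
    (tau_semiconj s hs).mul_aeval]

theorem reduce_surjective : Function.Surjective (reduce hs hh) := by
  have : NeZero (s ^ 2 - 1) := ⟨by have := Nat.one_lt_pow two_ne_zero hs; omega⟩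
  intro u
  induction u using MonoidAlgebra.induction_on with
  | of g =>
    obtain ⟨i, rfl⟩ := exists_pow_cyclicGen _ g
    exact ⟨aeval (AdjoinRoot.root _) (X ^ i), by
      rw [reduce_aeval, Polynomial.map_pow, map_X, map_pow, aeval_X, map_pow]⟩
  | add x y hx hy =>
    obtain ⟨x, rfl⟩ := hx
    obtain ⟨y, rfl⟩ := hy
    exact ⟨x + y, map_add _ _ _⟩
  | smul r x hx =>
    obtain ⟨x, rfl⟩ := hx
    refine ⟨aeval (AdjoinRoot.root _) (C (PowerSeries.C r)) * x, ?_⟩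
    rw [map_mul, reduce_aeval, map_C, aeval_C, PowerSeries.constantCoeff_C, Algebra.smul_def]

/-- The remainder modulo the monic `p` has degree below `s² - 1`, so by independence of the powers
of `σ` all its coefficients vanish modulo `t`. -/
theorem exists_eq_smul_of_reduce_eq_zero (hm : h.Monic) (hd : h.natDegree = s - 1)
    {a : AdjoinRoot (iterPoly h)} (ha : reduce hs hh a = 0) :
    ∃ b, a = (PowerSeries.X : k⟦X⟧) • b := by
  have hp := iterPoly.monic_natDegree hm (by omega)
  obtain ⟨f, rfl⟩ := AdjoinRoot.mk_surjective a
  have hn : s ^ 2 - 1 ≠ 0 := by have := Nat.one_lt_pow two_ne_zero hs; omega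
  have hfm : AdjoinRoot.mk (iterPoly h) f = AdjoinRoot.mk _ (f %ₘ iterPoly h) := by
    rw [AdjoinRoot.mk_eq_mk]
    exact ⟨f /ₘ iterPoly h, by linear_combination -(modByMonic_add_div f (iterPoly h))⟩
  have hdeg : (f %ₘ iterPoly h).natDegree < s ^ 2 - 1 := by
    have := natDegree_modByMonic_lt f hp.1 (by
      intro e
      have := hp.2
      rw [e, natDegree_one, hd, Nat.sub_add_cancel hs.le] at this
      exact hn this.symm)
    rwa [hp.2, hd, Nat.sub_add_cancel hs.le] at this
  rw [hfm] at ha ⊢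
  rw [← AdjoinRoot.aeval_eq, reduce_aeval] at ha
  have h0 := eq_zero_of_aeval_cyclicGen (natDegree_map_le.trans_lt hdeg) ha
  obtain ⟨g, hg⟩ : C (PowerSeries.X : k⟦X⟧) ∣ f %ₘ iterPoly h := by
    rw [C_dvd_iff_dvd_coeff]
    intro i
    rw [PowerSeries.X_dvd_iff, ← coeff_map, h0, coeff_zero]
  exact ⟨AdjoinRoot.mk _ g, by rw [hg, ← smul_eq_C_mul, AdjoinRoot.smul_mk]⟩

variable (hq : (h - 1) * q = iterPoly h)

/-- The reduction of the twisted quadratic extension of `k[[t]][x]/(p)` modulo `t`. -/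
noncomputable def reduceExt :
    (iterPoly.datum hq PowerSeries.X).Ext →ₐ[k] MonoidAlgebra k (GroupG s hs) :=
  { TwistDatum.Ext.lift (iterPoly.datum hq PowerSeries.X)
      ((inlAlg k s hs).toRingHom.comp (reduce hs hh)) (tau k s hs) (reduce_twist hs hh)
      (by
        have hc : reduce hs hh (iterPoly.datum hq PowerSeries.X).c = 0 := by
          change reduce hs hh (algebraMap k⟦X⟧ _ PowerSeries.X * _) = 0
          rw [map_mul, AdjoinRoot.algebraMap_eq, reduce, AdjoinRoot.lift_of, RingHom.comp_apply,
            PowerSeries.constantCoeff_X, map_zero, zero_mul]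
        rw [tau_mul_tau, RingHom.comp_apply, hc, map_zero, zero_mul, add_zero]) with
    commutes' := fun r => by
      change inlAlg k s hs (reduce hs hh (algebraMap k (iterPoly.datum hq PowerSeries.X).Ext r).1) +
        inlAlg k s hs (reduce hs hh (algebraMap k (iterPoly.datum hq PowerSeries.X).Ext r).2) *
          tau k s hs = _
      rw [TwistDatum.Ext.algebraMap_eq]
      simp only [TwistDatum.Ext.fst_mk, TwistDatum.Ext.snd_mk, map_zero, zero_mul, add_zero]
      rw [IsScalarTower.algebraMap_apply k k⟦X⟧, AdjoinRoot.algebraMap_eq,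
        reduce, AdjoinRoot.lift_of, RingHom.comp_apply, PowerSeries.algebraMap_apply,
        PowerSeries.constantCoeff_C]
      exact (inlAlg k s hs).commutes r }

theorem reduceExt_apply (a : (iterPoly.datum hq PowerSeries.X).Ext) :
    reduceExt hs hh hq a =
      inlAlg k s hs (reduce hs hh a.1) + inlAlg k s hs (reduce hs hh a.2) * tau k s hs := rfl

theorem reduceExt_surjective : Function.Surjective (reduceExt hs hh hq) := by
  have hinl (g) : ∃ a, reduceExt hs hh hq a =
      MonoidAlgebra.of k (GroupG s hs) (SemidirectProduct.inl g) := by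
    obtain ⟨a, ha⟩ := reduce_surjective hs hh (MonoidAlgebra.of k _ g)
    refine ⟨TwistDatum.Ext.of _ a, ?_⟩
    rw [reduceExt_apply, TwistDatum.Ext.fst_of, TwistDatum.Ext.snd_of, ha, inlAlg_of]
    simp
  have hinr (g) : ∃ a, reduceExt hs hh hq a =
      MonoidAlgebra.of k (GroupG s hs) (SemidirectProduct.inr g) := by
    obtain ⟨i, rfl⟩ := exists_pow_cyclicGen 2 g
    refine ⟨TwistDatum.Ext.gen _ ^ i, ?_⟩
    rw [map_pow, map_pow, map_pow, reduceExt_apply, TwistDatum.Ext.fst_gen,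
      TwistDatum.Ext.snd_gen]
    simp [tau]
  intro u
  induction u using MonoidAlgebra.induction_on with
  | of g =>
    obtain ⟨a, ha⟩ := hinl g.left
    obtain ⟨b, hb⟩ := hinr g.right
    refine ⟨a * b, ?_⟩
    rw [map_mul, ha, hb, ← map_mul, SemidirectProduct.inl_left_mul_inr_right]
  | add x y hx hy =>
    obtain ⟨x, rfl⟩ := hx
    obtain ⟨y, rfl⟩ := hy
    exact ⟨x + y, map_add _ _ _⟩
  | smul r x hx =>
    obtain ⟨x, rfl⟩ := hx
    exact ⟨r • x, map_smul _ _ _⟩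

theorem ker_reduceExt (hm : h.Monic) (hd : h.natDegree = s - 1) :
    uniformizerIdeal k (iterPoly.datum hq PowerSeries.X).Ext =
      RingHom.ker (reduceExt hs hh hq) := by
  apply le_antisymm
  · rw [uniformizerIdeal, Ideal.span_singleton_le_iff_mem, RingHom.mem_ker, reduceExt_apply,
      TwistDatum.Ext.algebraMap_eq, TwistDatum.Ext.fst_mk, TwistDatum.Ext.snd_mk,
      AdjoinRoot.algebraMap_eq, reduce, AdjoinRoot.lift_of, RingHom.comp_apply,
      PowerSeries.constantCoeff_X]
    simp
  · intro a ha
    rw [RingHom.mem_ker, reduceExt_apply] at ha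
    obtain ⟨b, hb⟩ :=
      exists_eq_smul_of_reduce_eq_zero hs hh hm hd (left_eq_zero s hs ha)
    obtain ⟨c, hc⟩ :=
      exists_eq_smul_of_reduce_eq_zero hs hh hm hd (right_eq_zero s hs ha)
    refine Ideal.mem_span_singleton'.2 ⟨TwistDatum.Ext.mk _ b c, ?_⟩
    rw [← Algebra.commutes, ← Algebra.smul_def]
    exact TwistDatum.Ext.ext hb.symm hc.symm

end GroupG

/-! ### Assembly of the deformation -/

theorem theoremB (s : ℕ) (hs : 1 < s) (k : Type u) [Field k] [CharP k 2] :
    HasSeparableDeformation k (MonoidAlgebra k (GroupG s hs)) := by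
  have hinj : Function.Injective (algebraMap k⟦X⟧ (AlgebraicClosure k⸨X⸩)) := by
    rw [IsScalarTower.algebraMap_eq k⟦X⟧ k⸨X⸩]
    exact (algebraMap k⸨X⸩ _).injective.comp (IsFractionRing.injective k⟦X⟧ k⸨X⸩)
  obtain ⟨h, hm, hd, hh, hsep⟩ :=
    iterPoly.exists_deforming_polynomial (k := k) (AlgebraicClosure k⸨X⸩) hinj hs
  obtain ⟨q, hq⟩ := iterPoly.sub_one_dvd h
  have hd0 : h.natDegree ≠ 0 := by omega
  have hn0 : NeZero (s ^ 2 - 1) := ⟨by have := Nat.one_lt_pow two_ne_zero hs; omega⟩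
  have hfin := iterPoly.finite_ext hq.symm (PowerSeries.X : k⟦X⟧) hm hd0
  have hfree := iterPoly.free_ext hq.symm (PowerSeries.X : k⟦X⟧) hm hd0
  have hG : Finite (GroupG s hs) := Finite.of_equiv _ SemidirectProduct.equivProd.symm
  refine ⟨k⸨X⸩ ⊗[k⟦X⟧] (iterPoly.datum hq.symm PowerSeries.X).Ext, inferInstance, inferInstance,
    ⟨(iterPoly.datum hq.symm PowerSeries.X).Ext, inferInstance, inferInstance, inferInstance,
      inferInstance, ⟨?_⟩, ⟨AlgEquiv.refl⟩, ⟨?_⟩⟩, inferInstance, ?_⟩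
  -- Only a linear identification is required, so it suffices that both free modules have rank `2
  -- (s² - 1)`.
  · apply LinearEquiv.ofFinrankEq
    rw [iterPoly.finrank_ext _ _ hm hd0, Module.finrank_baseChange,
      MonoidAlgebra.finrank_eq_card, SemidirectProduct.card, hd, Nat.sub_add_cancel hs.le,
      mul_comm]
    simp [CyclicGrp]
  · have : (RingHom.ker (GroupG.reduceExt hs hh hq.symm)).IsTwoSided := inferInstance
    exact (Ideal.quotientEquivAlgOfEq k (GroupG.ker_reduceExt hs hh hq.symm hm hd)).trans
      (Ideal.quotientKerAlgEquivOfSurjective (GroupG.reduceExt_surjective hs hh hq.symm))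
  · exact iterPoly.isSemisimpleRing_baseChange hq.symm PowerSeries.X k⸨X⸩
      (iterPoly.two_eq_zero k _) hm hd0 hsep
      ((map_ne_zero_iff _ hinj).2 PowerSeries.X_ne_zero)
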